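/- Let $m,n$ be nonnegative integers, let $p>m(m+1)$ and $\alpha>1-\frac{m(m+1)}{p}$ be real numbers, and let $\Sigma\subseteq\mathbb R^n$ be a compact embedded $m$-dimensional submanifold of class $C^{1,\alpha}$, possibly with boundary and corners. That is, $m\le n$, and for every $a\in\Sigma$ there are an integer $0\le k\le m$, open sets $U\ni a$ and $V$ in $\mathbb R^n$, and a homeomorphism $\Phi:U\to V$ such that $\Phi$ and $\Phi^{-1}$ are differentiable with $\alpha$-Hölder continuous derivatives and $$\Phi(\Sigma\cap U)=V\cap\big([0,\infty)^k\times\mathbb R^{m-k}\times\{0\}^{n-m}\big)$$ (submanifolds without boundary are the case $k=0$). For points $x_0,\dots,x_{m+1}\in\mathbb R^n$ put $$\mathcal K(x_0,\dots,x_{m+1})=\frac{\mathcal H^{m+1}(\operatorname{conv}\{x_0,\dots,x_{m+1}\})}{\operatorname{diam}(\{x_0,\dots,x_{m+1}\})^{m+2}},$$ where $\mathcal H^d$ is the $d$-dimensional Hausdorff measure, and $\mathcal K=0$ if all the points coincide. Then $$\mathcal E_p(\Sigma)=\int_{\Sigma^{m+2}}\mathcal K(x_0,\dots,x_{m+1})^p\,d\mathcal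 H^m_{x_0}\cdots d\mathcal H^m_{x_{m+1}}<\infty .$$ -/

import Mathlib

open MeasureTheory
open scoped ENNReal

noncomputable section

/-- The discrete curvature `K(T) = H^{m+1}(conv T) / diam(T)^{m+2}` of an `(m+2)`-tuple `T` of points
of `ℝⁿ`, as an extended nonnegative number. When all points coincide the quotient reads `0 / 0`, and
its value is `0`. (Mathlib's Hausdorff measure `μH[d]` is the standard one up to a positive constant
factor that depends only on `d`.) -/
def discreteCurvature {m n : ℕ} (T : Fin (m + 2) → EuclideanSpace ℝ (Fin n)) : ℝ≥0∞ :=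
  μH[(m : ℝ) + 1] (convexHull ℝ (Set.range T)) / Metric.ediam (Set.range T) ^ (m + 2)

/-- The `p`-energy: the integral over `S^{m+2}` of the `p`-th power of the discrete curvature, with
respect to the `(m+2)`-fold product of the `m`-dimensional Hausdorff measure on `S`. -/
def pEnergy {n : ℕ} (m : ℕ) (p : ℝ) (S : Set (EuclideanSpace ℝ (Fin n))) : ℝ≥0∞ :=
  ∫⁻ T : Fin (m + 2) → EuclideanSpace ℝ (Fin n), discreteCurvature T ^ p
    ∂(Measure.pi fun _ => (μH[(m : ℝ)] : Measure (EuclideanSpace ℝ (Fin n))).restrict S)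

/-- `f` is of class `C^{1,α}` on the open set `U` (used for `α > 0`): it is differentiable there, and
its derivative is `α`-Hölder continuous on `U`. -/
def IsC1Holder {n : ℕ} (α : ℝ) (f : EuclideanSpace ℝ (Fin n) → EuclideanSpace ℝ (Fin n))
    (U : Set (EuclideanSpace ℝ (Fin n))) : Prop :=
  DifferentiableOn ℝ f U ∧
    ∃ C : ℝ, ∀ x ∈ U, ∀ y ∈ U, ‖fderiv ℝ f x - fderiv ℝ f y‖ ≤ C * ‖x - y‖ ^ α

/-- The model set `([0,∞)^k × ℝ^{m-k}) × {0} ⊆ ℝ^m × ℝ^{n-m}` (for `k ≤ m ≤ n`). -/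
def modelCorner (n m k : ℕ) : Set (EuclideanSpace ℝ (Fin n)) :=
  {y | (∀ i : Fin n, (i : ℕ) < k → 0 ≤ y i) ∧ ∀ i : Fin n, m ≤ (i : ℕ) → y i = 0}

/-- `S` is an embedded `m`-dimensional submanifold of `ℝⁿ` of class `C^{1,α}`, possibly with boundary
and corners: near each of its points some `C^{1,α}` diffeomorphism `Φ` between open subsets of `ℝⁿ`
takes `S` to a model set. Submanifolds without boundary are those for which one can take `k = 0`
everywhere, and submanifolds with boundary those for which one can take `k ≤ 1`. -/
def IsC1HolderSubmanifold {n : ℕ} (m : ℕ) (α : ℝ) (S : Set (EuclideanSpace ℝ (Fin n))) : Prop :=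
  m ≤ n ∧ ∀ a ∈ S, ∃ Φ : OpenPartialHomeomorph (EuclideanSpace ℝ (Fin n)) (EuclideanSpace ℝ (Fin n)),
    a ∈ Φ.source ∧ IsC1Holder α Φ Φ.source ∧ IsC1Holder α Φ.symm Φ.target ∧
      ∃ k ≤ m, ∀ x ∈ Φ.source, x ∈ S ↔ Φ x ∈ modelCorner n m k

end

/-! A `C^{1,β}` submanifold deviates from its tangent plane at a point by `O(d^(1+β))` at scale `d`.
Hence `m + 1` secants of length at most `d` are linearly dependent up to that error, the simplex
they span has volume `O(d^m * d^(1+β))`, and `K(T) ≤ C * diam(T)^(β-1)`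
(`exists_discreteCurvature_le`).

Take `β = min α 1` and `t = (1-β)p/(m+1)`. As `diam T` dominates every `|x_i - x_0|`, `K^p` is at
most a constant times `∏ |x_i - x_0|^(-t)`. Fubini (`lintegral_pi_prod_le`) reduces finiteness to a
bound on `∫ |y - x|^(-t)` uniform in `x`. It holds for `t < m` because `S` is upper Ahlfors regular,
and trivially for `t = 0`. For `α < 1`, the assumption on `α` says exactly that `t < m`. -/

/-! ### Volume of thin simplices. -/

open scoped NNReal in
/-- The Hausdorff measure of a simplex whose edges at the vertex `T 0` have length at most `d` and
satisfy, up to an error `h`, a normalised linear relation with coefficients `c`. -/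
theorem hausdorffMeasure_convexHull_range_le {E : Type*} [NormedAddCommGroup E] [NormedSpace ℝ E]
    [MeasurableSpace E] [BorelSpace E] {m : ℕ} (T : Fin (m + 2) → E) (c : Fin (m + 1) → ℝ)
    (j : Fin (m + 1)) (hj : |c j| = 1) (hc : ∀ i, |c i| ≤ 1) {d h : ℝ} (hd : 0 < d) (hh : 0 < h)
    (hT : ∀ i : Fin (m + 1), ‖T i.succ - T 0‖ ≤ d)
    (hw : ‖∑ i : Fin (m + 1), c i • (T i.succ - T 0)‖ ≤ h) :
    μH[(m : ℝ) + 1] (convexHull ℝ (Set.range T)) ≤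
      ENNReal.ofReal ((m + 1) ^ (m + 1) * 2 ^ (m + 1) * (d ^ m * h)) := by
  classical
  set v : Fin (m + 1) → E := fun i => T i.succ - T 0 with hv
  set w : E := ∑ i, c i • v i with hw'
  -- The long edge `v j` is traded for the short vector `w`: the simplex lies in a Lipschitz image
  -- of a box with `m` sides `2d` and one side `2h`.
  let b : Fin (m + 1) → E := fun i => if i = j then h⁻¹ • w else d⁻¹ • v i
  let a : Fin (m + 1) → ℝ := fun i => if i = j then h else d
  have ha : ∀ i, 0 < a i := fun i => by dsimp only [a]; split_ifs <;> assumption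
  have hb : ∀ i, ‖b i‖ ≤ 1 := by
    intro i
    dsimp only [b]
    split_ifs
    · rw [norm_smul, norm_inv, Real.norm_of_nonneg hh.le, inv_mul_le_one₀ hh]; exact hw
    · rw [norm_smul, norm_inv, Real.norm_of_nonneg hd.le, inv_mul_le_one₀ hd]; exact hT i
  let L : (Fin (m + 1) → ℝ) →ₗ[ℝ] E := Fintype.linearCombination ℝ b
  have hL : ∀ u, L u = ∑ i, u i • b i := fun u => Fintype.linearCombination_apply ..
  let F : (Fin (m + 1) → ℝ) → E := fun u => T 0 + L u
  have hF : LipschitzWith (m + 1 : ℝ≥0) F := by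
    refine LipschitzWith.of_dist_le_mul fun u u' => ?_
    rw [dist_add_left, dist_eq_norm, ← map_sub, hL, dist_eq_norm]
    refine (norm_sum_le _ _).trans ((Finset.sum_le_card_nsmul _ _ ‖u - u'‖ fun i _ => ?_).trans ?_)
    · rw [norm_smul]
      exact (mul_le_of_le_one_right (norm_nonneg _) (hb i)).trans (norm_le_pi_norm (u - u') i)
    · simp
  set B : Set (Fin (m + 1) → ℝ) := Set.Icc (fun i => -a i) a with hB
  have hconv : Convex ℝ (F '' B) := by
    have : F '' B = (fun x => T 0 + x) '' (L '' B) := by rw [Set.image_image]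
    rw [this]
    exact ((convex_Icc _ _).linear_image L).translate (T 0)
  have hcj : c j * c j = 1 := by
    have := abs_mul_abs_self (c j); rw [hj] at this; linarith
  have hsub : convexHull ℝ (Set.range T) ⊆ F '' B := by
    refine convexHull_min ?_ hconv
    rintro _ ⟨k, rfl⟩
    refine Fin.cases ?_ (fun i => ?_) k
    · refine ⟨0, ⟨fun i => ?_, fun i => (ha i).le⟩, by simp [F]⟩
      simpa using (ha i).le
    · by_cases hij : i = j
      · subst hij
        -- Since `c i ^ 2 = 1`, the relation solves to `v i = c i • w - ∑_{l ≠ i} (c i * c l) • v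
        -- l`.
        refine ⟨fun l => if l = i then h * c i else -(d * (c i * c l)), ?_, ?_⟩
        · have key : ∀ l, |if l = i then h * c i else -(d * (c i * c l))| ≤ a l := by
            intro l
            dsimp only [a]
            split_ifs
            · rw [abs_mul, hj, abs_of_pos hh, mul_one]
            · rw [abs_neg, abs_mul, abs_mul, hj, abs_of_pos hd, one_mul]
              exact mul_le_of_le_one_right hd.le (hc l)
          exact ⟨fun l => (abs_le.1 (key l)).1, fun l => (abs_le.1 (key l)).2⟩
        · have e : ∀ l, (if l = i then h * c i else -(d * (c i * c l))) • b l
              = (if l = i then c i • w + (c i * c i) • v i else 0) - (c i * c l) • v l := by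
            intro l
            dsimp only [b]
            split_ifs with hl
            · subst hl
              rw [smul_smul, mul_right_comm, mul_inv_cancel₀ hh.ne', one_mul, add_sub_cancel_right]
            · rw [smul_smul, neg_mul, mul_right_comm, mul_inv_cancel₀ hd.ne', one_mul, neg_smul,
                zero_sub]
          dsimp only [F]
          rw [hL, Finset.sum_congr rfl fun l _ => e l, Finset.sum_sub_distrib,
            Finset.sum_ite_eq' Finset.univ i]
          simp only [Finset.mem_univ, if_true, mul_smul (c i)]
          rw [← Finset.smul_sum, ← hw', smul_smul, hcj, one_smul, add_sub_cancel_left, hv]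
          simp
      · refine ⟨Pi.single i d, ⟨fun l => ?_, fun l => ?_⟩, ?_⟩
        · have := (ha l).le
          by_cases hl : l = i
          · subst hl; simp; linarith
          · simp [hl, this]
        · by_cases hl : l = i
          · subst hl; simp [a, hij]
          · simp [hl, (ha l).le]
        · dsimp only [F]
          rw [hL, Finset.sum_eq_single i (fun l _ hl => by simp [hl]) (by simp)]
          simp [b, hij, hd.ne', hv]
  have hvol : volume B = ENNReal.ofReal (2 ^ (m + 1) * (d ^ m * h)) := by
    rw [hB, Real.volume_Icc_pi, ← ENNReal.ofReal_prod_of_nonneg fun i _ => by have := ha i; linarith]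
    congr 1
    have : ∀ i, a i - -a i = 2 * a i := fun i => by ring
    simp only [this]
    rw [Finset.prod_mul_distrib, Finset.prod_const, Finset.card_univ, Fintype.card_fin]
    congr 1
    rw [← Finset.mul_prod_erase _ _ (Finset.mem_univ j),
      Finset.prod_congr rfl (g := fun _ => d) fun i hi => by simp [a, Finset.ne_of_mem_erase hi]]
    simp [a, mul_comm]
  have hm : ((m : ℝ) + 1) = (Fintype.card (Fin (m + 1)) : ℝ) := by simp
  calc μH[(m : ℝ) + 1] (convexHull ℝ (Set.range T)) ≤ μH[(m : ℝ) + 1] (F '' B) :=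
        measure_mono hsub
    _ ≤ ((m + 1 : ℝ≥0) : ℝ≥0∞) ^ ((m : ℝ) + 1) * μH[(m : ℝ) + 1] B :=
        hF.hausdorffMeasure_image_le (by positivity) _
    _ = _ := by
        rw [hm, hausdorffMeasure_pi_real, hvol, mul_assoc, Fintype.card_fin,
          ENNReal.ofReal_mul (p := ((m + 1 : ℕ) : ℝ) ^ (m + 1)) (by positivity), ENNReal.rpow_natCast,
          ENNReal.ofReal_pow (p := ((m + 1 : ℕ) : ℝ)) (by positivity), ENNReal.ofReal_natCast]
        push_cast
        rfl

/-! ### Local charts. -/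

open scoped NNReal in
/-- Near each point of `U`, a `C^{1,α}` function is Lipschitz and has a first order expansion with
remainder of order `1 + β`, for all `0 < β ≤ α`. -/
theorem IsC1Holder.exists_ball {n : ℕ} {α β : ℝ}
    {f : EuclideanSpace ℝ (Fin n) → EuclideanSpace ℝ (Fin n)} {U : Set (EuclideanSpace ℝ (Fin n))}
    (hf : IsC1Holder α f U) (hU : IsOpen U) (hβ : 0 < β) (hβα : β ≤ α)
    {a : EuclideanSpace ℝ (Fin n)} (ha : a ∈ U) :
    ∃ ρ > 0, ∃ L : ℝ≥0, ∃ C ≥ 0, Metric.ball a ρ ⊆ U ∧ LipschitzOnWith L f (Metric.ball a ρ) ∧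
      ∀ y ∈ Metric.ball a ρ, ∀ z ∈ Metric.ball a ρ,
        ‖f z - f y - fderiv ℝ f y (z - y)‖ ≤ C * ‖z - y‖ ^ (1 + β) := by
  obtain ⟨hd, C, hC⟩ := hf
  obtain ⟨ε, hε, hεU⟩ := Metric.isOpen_iff.1 hU a ha
  -- Radius at most `1/2` keeps mutual distances at most `1`, where the exponent `α` may be lowered
  -- to `β`.
  have hρ : 0 < min ε (1 / 2) := lt_min hε (by norm_num)
  have hsub : Metric.ball a (min ε (1 / 2)) ⊆ U :=
    (Metric.ball_subset_ball (min_le_left _ _)).trans hεU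
  have hdiff : ∀ x ∈ Metric.ball a (min ε (1 / 2)), DifferentiableAt ℝ f x := fun x hx =>
    hd.differentiableAt (hU.mem_nhds (hsub hx))
  have hle : ∀ x ∈ Metric.ball a (min ε (1 / 2)), ∀ y ∈ Metric.ball a (min ε (1 / 2)), ∀ r,
      ‖x - y‖ ≤ r → r ≤ 1 → ‖fderiv ℝ f x - fderiv ℝ f y‖ ≤ |C| * r ^ β := by
    intro x hx y hy r hr hr1
    refine (hC x (hsub hx) y (hsub hy)).trans ?_
    have h0 := norm_nonneg (x - y)
    calc C * ‖x - y‖ ^ α ≤ |C| * ‖x - y‖ ^ α := by gcongr; exact le_abs_self C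
      _ ≤ |C| * ‖x - y‖ ^ β := mul_le_mul_of_nonneg_left
        (Real.rpow_le_rpow_of_exponent_ge' h0 (hr.trans hr1) hβ.le hβα) (abs_nonneg C)
      _ ≤ |C| * r ^ β := by gcongr
  have hdist : ∀ x ∈ Metric.ball a (min ε (1 / 2)), ∀ y ∈ Metric.ball a (min ε (1 / 2)),
      ‖x - y‖ ≤ 1 := by
    intro x hx y hy
    rw [← dist_eq_norm]
    have h1 := (Metric.mem_ball.1 hx).le.trans (min_le_right _ _)
    have h2 := (Metric.mem_ball.1 hy).le.trans (min_le_right _ _)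
    have := dist_triangle_right x y a
    linarith
  refine ⟨_, hρ, (‖fderiv ℝ f a‖ + |C|).toNNReal, |C|, abs_nonneg C, hsub, ?_, ?_⟩
  · refine (convex_ball _ _).lipschitzOnWith_of_nnnorm_fderiv_le hdiff fun x hx => ?_
    rw [← NNReal.coe_le_coe, Real.coe_toNNReal _ (by positivity), coe_nnnorm]
    have h1 := hle x hx a (Metric.mem_ball_self hρ) 1
      (hdist x hx a (Metric.mem_ball_self hρ)) le_rfl
    rw [Real.one_rpow, mul_one] at h1
    have := norm_le_norm_add_norm_sub' (fderiv ℝ f x) (fderiv ℝ f a)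
    linarith
  · intro y hy z hz
    have hseg : segment ℝ y z ⊆ Metric.ball a (min ε (1 / 2)) := (convex_ball _ _).segment_subset hy hz
    have := (convex_segment y z).norm_image_sub_le_of_norm_hasFDerivWithin_le'
      (f := f) (f' := fderiv ℝ f) (φ := fderiv ℝ f y) (C := |C| * ‖z - y‖ ^ β)
      (fun x hx => (hdiff x (hseg hx)).hasFDerivAt.hasFDerivWithinAt)
      (fun x hx => hle x (hseg hx) y hy _ (norm_sub_le_of_mem_segment hx) (hdist z hz y hy))
      (left_mem_segment ℝ y z) (right_mem_segment ℝ y z)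
    refine this.trans_eq ?_
    rw [add_comm, Real.rpow_add_one' (norm_nonneg _) (by linarith), mul_assoc]

open scoped NNReal in
/-- A `C^{1,α}` submanifold is, near each of its points, parametrised by a Lipschitz map with
Lipschitz inverse and with a first order expansion with remainder of order `1 + β`. -/
theorem IsC1HolderSubmanifold.exists_chart {n m : ℕ} {α β : ℝ}
    {S : Set (EuclideanSpace ℝ (Fin n))} (hS : IsC1HolderSubmanifold m α S)
    (hβ : 0 < β) (hβα : β ≤ α) {a : EuclideanSpace ℝ (Fin n)} (ha : a ∈ S) :
    ∃ ρ > 0, ∃ (f g : EuclideanSpace ℝ (Fin n) → EuclideanSpace ℝ (Fin n))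
      (A : Set (EuclideanSpace ℝ (Fin n))) (L : ℝ≥0), ∃ C ≥ 0,
      (∀ x ∈ S ∩ Metric.ball a ρ, f x ∈ A ∧ g (f x) = x ∧ ∀ i : Fin n, m ≤ i → f x i = 0) ∧
      LipschitzOnWith L f (Metric.ball a ρ) ∧ LipschitzOnWith L g A ∧
      ∀ y ∈ A, ∃ D : EuclideanSpace ℝ (Fin n) →L[ℝ] EuclideanSpace ℝ (Fin n), ∀ z ∈ A,
        ‖g z - g y - D (z - y)‖ ≤ C * ‖z - y‖ ^ (1 + β) := by
  obtain ⟨Φ, haΦ, hf, hg, k, -, hk⟩ := hS.2 a ha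
  obtain ⟨ρ₁, hρ₁, L₁, -, -, hs₁, hL₁, -⟩ := hf.exists_ball Φ.open_source hβ hβα haΦ
  obtain ⟨ρ₂, hρ₂, L₂, C, hC, -, hL₂, hT⟩ :=
    hg.exists_ball Φ.open_target hβ hβα (Φ.map_source haΦ)
  obtain ⟨ε, hε, hεb⟩ := Metric.continuousAt_iff.1 (Φ.continuousAt haΦ) ρ₂ hρ₂
  refine ⟨min ρ₁ ε, lt_min hρ₁ hε, Φ, Φ.symm, Metric.ball (Φ a) ρ₂, max L₁ L₂, C, hC, ?_,
    (hL₁.mono (Metric.ball_subset_ball (min_le_left _ _))).weaken (le_max_left _ _),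
    hL₂.weaken (le_max_right _ _), fun y hy => ⟨_, hT y hy⟩⟩
  rintro x ⟨hxS, hx⟩
  have hxs : x ∈ Φ.source := hs₁ (Metric.ball_subset_ball (min_le_left _ _) hx)
  exact ⟨hεb (lt_of_lt_of_le hx (min_le_right _ _)), Φ.left_inv hxs, ((hk x hxs).1 hxS).2⟩

/-! ### Singular integrals and Fubini. -/

/-- The integral of `edist x y ^ (-t)` over `y` is bounded by this constant if the measure of balls
of radius `r` around `x` is at most `C * r ^ m`. -/
theorem lintegral_edist_rpow_neg_le {X : Type*} [PseudoMetricSpace X] [MeasurableSpace X]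
    [OpensMeasurableSpace X] (μ : Measure X) {m : ℕ} {t : ℝ} (ht : 0 ≤ t) {C : ℝ≥0∞} {x : X}
    (hμ : ∀ r > 0, μ (Metric.closedBall x r) ≤ C * ENNReal.ofReal (r ^ m)) :
    ∫⁻ y, edist y x ^ (-t) ∂μ ≤
      μ Set.univ + C * ENNReal.ofReal (2 ^ t) * ∑' k : ℕ, ENNReal.ofReal ((2 ^ (t - m)) ^ k) := by
  -- Dyadic decomposition: the `k`-th term controls the shell `2^(-k-1) < dist y x ≤ 2^(-k)`. At
  -- distance `0` every term is at least `1`, so the series is infinite.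
  have hpt : ∀ y, edist y x ^ (-t) ≤ 1 + ∑' k : ℕ,
      (Metric.closedBall x ((1 / 2) ^ k)).indicator
        (fun _ => ENNReal.ofReal (2 ^ (t * (k + 1)))) y := by
    intro y
    rcases (dist_nonneg (x := y) (y := x)).eq_or_lt with h0 | h0
    · refine le_top.trans (le_of_eq ?_)
      symm
      rw [ENNReal.add_eq_top]
      right
      have hone : ∀ k : ℕ, (1 : ℝ≥0∞) ≤ (Metric.closedBall x ((1 / 2 : ℝ) ^ k)).indicator
        (fun _ => ENNReal.ofReal (2 ^ (t * (k + 1)))) y := by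
        intro k
        rw [Set.indicator_of_mem (by rw [Metric.mem_closedBall, ← h0]; positivity)]
        rw [ENNReal.one_le_ofReal]
        exact Real.one_le_rpow (by norm_num) (by positivity)
      refine top_le_iff.1 (le_trans (le_of_eq ?_) (ENNReal.tsum_le_tsum hone))
      simp
    · rw [edist_dist, ENNReal.ofReal_rpow_of_pos h0]
      rcases le_or_gt 1 (dist y x) with h1 | h1
      · refine le_add_right ?_
        rw [ENNReal.ofReal_le_one]
        exact Real.rpow_le_one_of_one_le_of_nonpos h1 (by linarith)
      · obtain ⟨k, hk, hk'⟩ := exists_nat_pow_near_of_lt_one h0 h1.le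
          (by norm_num : (0 : ℝ) < 1 / 2) (by norm_num)
        refine le_add_left (le_trans ?_ (ENNReal.le_tsum k))
        rw [Set.indicator_of_mem (Metric.mem_closedBall.2 hk')]
        refine ENNReal.ofReal_le_ofReal ?_
        refine (Real.rpow_le_rpow_of_nonpos (by positivity) hk.le (by linarith)).trans_eq ?_
        rw [one_div, inv_pow, Real.inv_rpow (by positivity), ← Real.rpow_neg (by positivity),
          neg_neg, ← Real.rpow_natCast, ← Real.rpow_mul (by norm_num), mul_comm]
        push_cast
        rfl
  calc ∫⁻ y, edist y x ^ (-t) ∂μ ≤ ∫⁻ y, 1 + ∑' k : ℕ,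
      (Metric.closedBall x ((1 / 2) ^ k)).indicator
        (fun _ => ENNReal.ofReal (2 ^ (t * (k + 1)))) y ∂μ := lintegral_mono hpt
    _ = μ Set.univ + ∑' k : ℕ,
        ENNReal.ofReal (2 ^ (t * (k + 1))) * μ (Metric.closedBall x ((1 / 2) ^ k)) := by
      rw [lintegral_add_left measurable_const, lintegral_one, lintegral_tsum]
      · congr 1
        exact tsum_congr fun k => lintegral_indicator_const Metric.isClosed_closedBall.measurableSet _
      · exact fun k => (measurable_const.indicator Metric.isClosed_closedBall.measurableSet).aemeasurable
    _ ≤ _ := by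
      rw [← ENNReal.tsum_mul_left]
      refine add_le_add le_rfl (ENNReal.tsum_le_tsum fun k => ?_)
      refine (mul_le_mul_right (hμ ((1 / 2) ^ k) (by positivity)) _).trans_eq ?_
      rw [mul_left_comm, mul_assoc, ← ENNReal.ofReal_mul (by positivity),
        ← ENNReal.ofReal_mul (by positivity)]
      congr 2
      rw [← pow_mul, ← Real.rpow_natCast _ k, ← Real.rpow_mul (by norm_num), one_div, inv_pow,
        ← Real.rpow_natCast, ← Real.rpow_neg (by norm_num), ← Real.rpow_add (by norm_num),
        ← Real.rpow_add (by norm_num)]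
      push_cast
      ring_nf

theorem tsum_ofReal_two_rpow_pow_lt_top {s : ℝ} (hs : s < 0) :
    ∑' k : ℕ, ENNReal.ofReal ((2 ^ s) ^ k) < ∞ :=
  (summable_geometric_of_lt_one (by positivity)
    (Real.rpow_lt_one_of_one_lt_of_neg (by norm_num) hs)).tsum_ofReal_lt_top

/-- Fubini for a product of functions of the remaining coordinates and the first one. -/
theorem lintegral_pi_prod_le {X : Type*} [MeasurableSpace X] (μ : Measure X) [IsFiniteMeasure μ]
    (k : ℕ) {f : X → X → ℝ≥0∞} (hf : Measurable (Function.uncurry f)) {A : ℝ≥0∞}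
    (hA : ∀ x, ∫⁻ y, f y x ∂μ ≤ A) :
    ∫⁻ T : Fin (k + 1) → X, ∏ i : Fin k, f (T i.succ) (T 0) ∂(Measure.pi fun _ => μ) ≤
      μ Set.univ * A ^ k := by
  have hprod : ∀ (l : ℕ) (x : X),
      ∫⁻ T : Fin l → X, ∏ i, f (T i) x ∂(Measure.pi fun _ => μ) ≤ A ^ l := by
    intro l x
    have hfx : Measurable fun y => f y x := hf.comp (measurable_id.prodMk measurable_const)
    induction l with
    | zero => simp
    | succ l ih =>
      rw [← ((measurePreserving_piFinSuccAbove (fun _ : Fin (l + 1) => μ) 0).symm).lintegral_comp_emb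
        (MeasurableEquiv.measurableEmbedding _)]
      simp_rw [MeasurableEquiv.piFinSuccAbove_symm_apply, Fin.insertNthEquiv,
        Fin.prod_univ_succ, Equiv.coe_fn_mk, Fin.insertNth_zero, Fin.cons_succ, Fin.cons_zero]
      have hg : Measurable fun T : Fin l → X => ∏ i, f (T i) x :=
        Finset.measurable_fun_prod _ fun i _ => hfx.comp (measurable_pi_apply i)
      simp only [cast_eq]
      rw [lintegral_prod_mul (g := fun T : Fin l → X => ∏ i, f (T i) x) hfx.aemeasurable
        hg.aemeasurable, pow_succ']
      exact mul_le_mul' (hA x) ih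
  rw [← ((measurePreserving_piFinSuccAbove (fun _ : Fin (k + 1) => μ) 0).symm).lintegral_comp_emb
    (MeasurableEquiv.measurableEmbedding _)]
  simp_rw [MeasurableEquiv.piFinSuccAbove_symm_apply, Fin.insertNthEquiv,
    Equiv.coe_fn_mk, Fin.insertNth_zero, Fin.cons_succ, Fin.cons_zero]
  have hg : Measurable fun a : X × (Fin k → X) => ∏ i, f (a.2 i) a.1 :=
    Finset.measurable_fun_prod _ fun i _ =>
      hf.comp (g := Function.uncurry f) (f := fun a : X × (Fin k → X) => (a.2 i, a.1))
        (((measurable_pi_apply i).comp measurable_snd).prodMk measurable_fst)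
  simp only [cast_eq]
  rw [lintegral_prod _ hg.aemeasurable]
  refine (lintegral_mono fun x => hprod k x).trans_eq ?_
  rw [lintegral_const, mul_comm]

/-! ### Flatness and Ahlfors regularity. -/

/-- `m + 1` vectors in `ℝᵐ` satisfy a linear relation whose largest coefficient is `±1`. -/
theorem exists_normalized_linear_relation {m : ℕ} (u : Fin (m + 1) → Fin m → ℝ) :
    ∃ c : Fin (m + 1) → ℝ, ∃ j, |c j| = 1 ∧ (∀ i, |c i| ≤ 1) ∧ ∑ i, c i • u i = 0 := by
  have hu : ¬ LinearIndependent ℝ u := fun h => by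
    have := h.fintype_card_le_finrank
    simp at this
  obtain ⟨c, hc, i, hi⟩ := Fintype.not_linearIndependent_iff.1 hu
  obtain ⟨j, hj⟩ := Finite.exists_max fun i => |c i|
  have hj0 : 0 < |c j| := (abs_pos.2 hi).trans_le (hj i)
  refine ⟨fun i => |c j|⁻¹ * c i, j, ?_, fun i => ?_, ?_⟩
  · rw [abs_mul, abs_inv, abs_abs, inv_mul_cancel₀ hj0.ne']
  · rw [abs_mul, abs_inv, abs_abs, inv_mul_le_one₀ hj0]
    exact hj i
  · simp_rw [mul_smul]
    rw [← Finset.smul_sum, hc, smul_zero]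

/-- Any `m + 1` secants from a point of a compact `C^{1,α}` submanifold of dimension `m` satisfy a
normalised linear relation up to an error of order `1 + β`. -/
theorem IsC1HolderSubmanifold.exists_approx_linear_relation {n m : ℕ} {α β : ℝ}
    {S : Set (EuclideanSpace ℝ (Fin n))} (hS : IsC1HolderSubmanifold m α S) (hSc : IsCompact S)
    (hβ : 0 < β) (hβα : β ≤ α) :
    ∃ C > 0, ∀ T : Fin (m + 2) → EuclideanSpace ℝ (Fin n), (∀ i, T i ∈ S) → ∀ d > 0,
      (∀ i : Fin (m + 1), ‖T i.succ - T 0‖ ≤ d) →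
      ∃ c : Fin (m + 1) → ℝ, ∃ j, |c j| = 1 ∧ (∀ i, |c i| ≤ 1) ∧
        ‖∑ i : Fin (m + 1), c i • (T i.succ - T 0)‖ ≤ C * d ^ (1 + β) := by
  -- Only the vertex `T 0` is localised in the induction over the compact set; the other vertices
  -- range over all of `S`.
  suffices h : ∃ C > 0, ∀ T : Fin (m + 2) → EuclideanSpace ℝ (Fin n), (∀ i, T i ∈ S) → T 0 ∈ S →
      ∀ d > 0, (∀ i : Fin (m + 1), ‖T i.succ - T 0‖ ≤ d) →
      ∃ c : Fin (m + 1) → ℝ, ∃ j, |c j| = 1 ∧ (∀ i, |c i| ≤ 1) ∧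
        ‖∑ i : Fin (m + 1), c i • (T i.succ - T 0)‖ ≤ C * d ^ (1 + β) by
    obtain ⟨C, hC, h⟩ := h
    exact ⟨C, hC, fun T hT => h T hT (hT 0)⟩
  refine hSc.induction_on (p := fun A => ∃ C > 0, ∀ T : Fin (m + 2) → EuclideanSpace ℝ (Fin n),
      (∀ i, T i ∈ S) → T 0 ∈ A → ∀ d > 0, (∀ i : Fin (m + 1), ‖T i.succ - T 0‖ ≤ d) →
      ∃ c : Fin (m + 1) → ℝ, ∃ j, |c j| = 1 ∧ (∀ i, |c i| ≤ 1) ∧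
        ‖∑ i : Fin (m + 1), c i • (T i.succ - T 0)‖ ≤ C * d ^ (1 + β))
    ⟨1, one_pos, by simp⟩ ?_ ?_ ?_
  · rintro A B hAB ⟨C, hC, h⟩
    exact ⟨C, hC, fun T hT h0 => h T hT (hAB h0)⟩
  · rintro A B ⟨C₁, hC₁, h₁⟩ ⟨C₂, hC₂, h₂⟩
    refine ⟨max C₁ C₂, lt_max_of_lt_left hC₁, fun T hT h0 d hd hTd => ?_⟩
    have hd' : 0 ≤ d ^ (1 + β) := by positivity
    rcases h0 with h0 | h0
    · obtain ⟨c, j, hj, hc, h⟩ := h₁ T hT h0 d hd hTd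
      exact ⟨c, j, hj, hc, h.trans (mul_le_mul_of_nonneg_right (le_max_left _ _) hd')⟩
    · obtain ⟨c, j, hj, hc, h⟩ := h₂ T hT h0 d hd hTd
      exact ⟨c, j, hj, hc, h.trans (mul_le_mul_of_nonneg_right (le_max_right _ _) hd')⟩
  · intro a ha
    obtain ⟨ρ, hρ, f, g, A, L, C, hC, hfg, hf, -, hD⟩ := hS.exists_chart hβ hβα ha
    refine ⟨S ∩ Metric.ball a (ρ / 2), Filter.inter_mem self_mem_nhdsWithin
      (mem_nhdsWithin_of_mem_nhds (Metric.ball_mem_nhds a (by positivity))),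
      -- The first summand serves tuples inside one chart. The second serves `d ≥ ρ / 2`, where a
      -- single edge is already a good enough relation.
      (m + 1) * (C * L ^ (1 + β)) + (ρ / 2) ^ (-β), by positivity, ?_⟩
    rintro T hT ⟨-, h0⟩ d hd hTd
    have hd' : 0 ≤ d ^ (1 + β) := by positivity
    rcases le_or_gt (ρ / 2) d with hρd | hρd
    · refine ⟨Pi.single 0 1, 0, by simp, fun i => ?_, ?_⟩
      · by_cases hi : i = 0
        · subst hi; simp
        · simp [hi]
      · rw [Finset.sum_eq_single 0 (fun l _ hl => by simp [hl]) (by simp)]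
        simp only [Pi.single_eq_same, one_smul]
        have h1 : 1 ≤ (ρ / 2) ^ (-β) * d ^ β := by
          rw [Real.rpow_neg (by positivity), ← div_eq_inv_mul, one_le_div (by positivity)]
          gcongr
        calc ‖T (Fin.succ 0) - T 0‖ ≤ 1 * d := by rw [one_mul]; exact hTd 0
          _ ≤ ((ρ / 2) ^ (-β) * d ^ β) * d := by gcongr
          _ = (ρ / 2) ^ (-β) * d ^ (1 + β) := by
            rw [add_comm, Real.rpow_add_one' hd.le (by linarith), mul_assoc]
          _ ≤ _ := by gcongr; exact le_add_of_nonneg_left (by positivity)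
    · have hmem : ∀ i, T i ∈ Metric.ball a ρ := by
        refine Fin.cases (Metric.ball_subset_ball (by linarith) h0) fun i => ?_
        have h1 := hTd i
        rw [← dist_eq_norm] at h1
        have h2 := dist_triangle (T i.succ) (T 0) a
        rw [Metric.mem_ball] at h0 ⊢
        linarith
      have hx := fun i => hfg (T i) ⟨hT i, hmem i⟩
      obtain ⟨D, hD⟩ := hD _ (hx 0).1
      obtain ⟨c, j, hj, hc, hsum⟩ := exists_normalized_linear_relation
        fun (i : Fin (m + 1)) l => (f (T i.succ) - f (T 0)) (Fin.castLE hS.1 l)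
      have hsum' : ∑ i : Fin (m + 1), c i • (f (T i.succ) - f (T 0)) = 0 := by
        ext l
        rw [WithLp.ofLp_sum, Finset.sum_apply]
        rcases lt_or_ge (l : ℕ) m with hl | hl
        · have := congrFun hsum ⟨l, hl⟩
          rw [Finset.sum_apply] at this
          simpa using this
        · exact Finset.sum_eq_zero fun i _ => by simp [(hx _).2.2 l hl]
      refine ⟨c, j, hj, hc, ?_⟩
      -- The relation is exact in the chart, so the linear part `D` cancels and only Taylor
      -- remainders survive.
      have heq : ∑ i : Fin (m + 1), c i • (T i.succ - T 0) = ∑ i : Fin (m + 1), c i •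
          (g (f (T i.succ)) - g (f (T 0)) - D (f (T i.succ) - f (T 0))) := by
        simp_rw [smul_sub _ (_ - _) (D _), Finset.sum_sub_distrib, ← map_smul, ← map_sum, (hx _).2.1]
        rw [hsum', map_zero, sub_zero]
      rw [heq]
      refine (norm_sum_le _ _).trans ((Finset.sum_le_card_nsmul _ _ (C * (L * d) ^ (1 + β))
        fun i _ => ?_).trans ?_)
      · rw [norm_smul]
        refine (mul_le_of_le_one_left (norm_nonneg _) (hc i)).trans ((hD _ (hx _).1).trans ?_)
        gcongr
        refine (hf.norm_sub_le (hmem _) (hmem _)).trans ?_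
        gcongr
        exact hTd i
      · rw [Finset.card_univ, Fintype.card_fin, nsmul_eq_mul, Real.mul_rpow L.coe_nonneg hd.le,
          add_mul]
        push_cast
        refine le_add_of_le_of_nonneg (le_of_eq (by ring)) (by positivity)

/-- Compact `m`-dimensional submanifolds are upper Ahlfors regular. -/
theorem IsC1HolderSubmanifold.exists_hausdorffMeasure_inter_closedBall_le {n m : ℕ} {α : ℝ}
    {S : Set (EuclideanSpace ℝ (Fin n))} (hS : IsC1HolderSubmanifold m α S) (hSc : IsCompact S)
    (hα : 0 < α) :
    ∃ C < ∞, ∀ x, ∀ r > 0,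
      μH[(m : ℝ)] (S ∩ Metric.closedBall x r) ≤ C * ENNReal.ofReal (r ^ m) := by
  refine hSc.induction_on (p := fun A => ∃ C < ∞, ∀ x, ∀ r > 0,
      μH[(m : ℝ)] (A ∩ Metric.closedBall x r) ≤ C * ENNReal.ofReal (r ^ m))
    ⟨0, by simp, by simp⟩ ?_ ?_ ?_
  · rintro A B hAB ⟨C, hC, h⟩
    exact ⟨C, hC, fun x r hr => (measure_mono (Set.inter_subset_inter_left _ hAB)).trans (h x r hr)⟩
  · rintro A B ⟨C₁, hC₁, h₁⟩ ⟨C₂, hC₂, h₂⟩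
    refine ⟨C₁ + C₂, ENNReal.add_lt_top.2 ⟨hC₁, hC₂⟩, fun x r hr => ?_⟩
    rw [Set.union_inter_distrib_right, add_mul]
    exact (measure_union_le _ _).trans (add_le_add (h₁ x r hr) (h₂ x r hr))
  · intro a ha
    obtain ⟨ρ, hρ, f, g, A, L, -, -, hfg, hf, hg, -⟩ := hS.exists_chart hα le_rfl ha
    -- The parameter space carries the sup metric, for which `μH[m]` equals Lebesgue measure.
    let ι : (Fin m → ℝ) →ₗ[ℝ] EuclideanSpace ℝ (Fin n) :=
      { toFun := fun w => WithLp.toLp 2 fun i => if h : (i : ℕ) < m then w ⟨i, h⟩ else 0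
        map_add' := fun v w => by ext i; by_cases h : (i : ℕ) < m <;> simp [h]
        map_smul' := fun v w => by ext i; by_cases h : (i : ℕ) < m <;> simp [h] }
    let π : EuclideanSpace ℝ (Fin n) → Fin m → ℝ := fun y l => y (Fin.castLE hS.1 l)
    have hι := (LinearMap.toContinuousLinearMap ι).lipschitz
    set K := ‖LinearMap.toContinuousLinearMap ι‖₊
    have hιπ : ∀ y : EuclideanSpace ℝ (Fin n), (∀ i : Fin n, m ≤ i → y i = 0) → ι (π y) = y := by
      intro y hy
      ext i
      by_cases h : (i : ℕ) < m
      · simp [ι, π, h]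
      · simp [ι, h, hy i (not_lt.1 h)]
    refine ⟨S ∩ Metric.ball a ρ, Filter.inter_mem self_mem_nhdsWithin
      (mem_nhdsWithin_of_mem_nhds (Metric.ball_mem_nhds a hρ)),
      (L : ℝ≥0∞) ^ m * ((K : ℝ≥0∞) ^ m * ENNReal.ofReal ((4 * L) ^ m)), ?_, fun x r hr => ?_⟩
    · exact ENNReal.mul_lt_top (ENNReal.pow_lt_top ENNReal.coe_lt_top)
        (ENNReal.mul_lt_top (ENNReal.pow_lt_top ENNReal.coe_lt_top) ENNReal.ofReal_lt_top)
    rcases (S ∩ Metric.ball a ρ ∩ Metric.closedBall x r).eq_empty_or_nonempty with he | ⟨z, hz, hzx⟩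
    · simp [he]
    -- The centre `x` need not lie on `S`; recentring at `z` doubles the radius.
    set B := Metric.closedBall (π (f z)) (2 * L * r)
    have hsub : S ∩ Metric.ball a ρ ∩ Metric.closedBall x r ⊆ g '' (A ∩ ι '' B) := by
      rintro y ⟨hy, hyx⟩
      obtain ⟨h1, h2, h3⟩ := hfg y hy
      refine ⟨f y, ⟨h1, π (f y), ?_, hιπ _ h3⟩, h2⟩
      rw [Metric.mem_closedBall, dist_pi_le_iff (by positivity)]
      intro l
      have hyz : dist y z ≤ 2 * r := by
        have := dist_triangle_right y z x
        rw [Metric.mem_closedBall] at hyx hzx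
        linarith
      have hfd := hf.dist_le_mul y hy.2 z hz.2
      calc dist (π (f y) l) (π (f z) l) = ‖(f y - f z) (Fin.castLE hS.1 l)‖ := by
            rw [dist_eq_norm]; rfl
        _ ≤ ‖f y - f z‖ := PiLp.norm_apply_le _ _
        _ ≤ L * (2 * r) := by
          rw [← dist_eq_norm]; exact hfd.trans (by gcongr)
        _ = 2 * L * r := by ring
    have hvol : μH[(m : ℝ)] B = ENNReal.ofReal ((4 * L) ^ m) * ENNReal.ofReal (r ^ m) := by
      have hm : (m : ℝ) = (Fintype.card (Fin m) : ℝ) := by simp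
      rw [hm, hausdorffMeasure_pi_real, Real.volume_pi_closedBall _ (by positivity),
        ← ENNReal.ofReal_mul (by positivity), Fintype.card_fin, ← mul_pow]
      congr 2
      ring
    calc μH[(m : ℝ)] (S ∩ Metric.ball a ρ ∩ Metric.closedBall x r)
        ≤ μH[(m : ℝ)] (g '' (A ∩ ι '' B)) := measure_mono hsub
      _ ≤ (L : ℝ≥0∞) ^ (m : ℝ) * μH[(m : ℝ)] (A ∩ ι '' B) :=
        (hg.mono Set.inter_subset_left).hausdorffMeasure_image_le (by positivity)
      _ ≤ (L : ℝ≥0∞) ^ (m : ℝ) * ((K : ℝ≥0∞) ^ (m : ℝ) * μH[(m : ℝ)] B) := by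
        gcongr
        exact (measure_mono Set.inter_subset_right).trans
          (hι.hausdorffMeasure_image_le (by positivity) B)
      _ = _ := by
        rw [hvol, ENNReal.rpow_natCast, ENNReal.rpow_natCast]
        ring

/-! ### Curvature bound and finiteness of the energy. -/

/-- On a compact `C^{1,α}` submanifold, `K(T)` is at most of order `diam(T) ^ (β - 1)`. -/
theorem IsC1HolderSubmanifold.exists_discreteCurvature_le {n m : ℕ} {α β : ℝ}
    {S : Set (EuclideanSpace ℝ (Fin n))} (hS : IsC1HolderSubmanifold m α S) (hSc : IsCompact S)
    (hβ : 0 < β) (hβα : β ≤ α) :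
    ∃ C < ∞, ∀ T : Fin (m + 2) → EuclideanSpace ℝ (Fin n), (∀ i, T i ∈ S) →
      discreteCurvature T ≤ C * Metric.ediam (Set.range T) ^ (β - 1) := by
  obtain ⟨C, hC, h⟩ := hS.exists_approx_linear_relation hSc hβ hβα
  refine ⟨ENNReal.ofReal ((m + 1) ^ (m + 1) * 2 ^ (m + 1) * C), ENNReal.ofReal_lt_top,
    fun T hT => ?_⟩
  have hdist : ∀ i j, edist (T i) (T j) ≤ Metric.ediam (Set.range T) := fun i j =>
    Metric.edist_le_ediam_of_mem (Set.mem_range_self i) (Set.mem_range_self j)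
  have htop : Metric.ediam (Set.range T) ≠ ∞ := (Set.finite_range T).isBounded.ediam_ne_top
  set D := Metric.ediam (Set.range T) with hD
  rcases eq_or_ne D 0 with h0 | h0
  · have hsing : Set.range T = {T 0} := by
      refine Set.eq_singleton_iff_unique_mem.2 ⟨Set.mem_range_self 0, ?_⟩
      rintro _ ⟨i, rfl⟩
      exact edist_le_zero.1 ((hdist i 0).trans_eq h0)
    have : discreteCurvature T = 0 := by
      have h1 : μH[(m : ℝ) + 1] (convexHull ℝ (Set.range T)) = 0 := by
        rw [hsing, convexHull_singleton]
        have := Measure.nullSingletonClass_hausdorff (EuclideanSpace ℝ (Fin n))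
          (by positivity : (0 : ℝ) < (m : ℝ) + 1)
        exact measure_singleton _
      rw [discreteCurvature, h1, ENNReal.zero_div]
    rw [this]
    exact zero_le
  · set d := D.toReal
    have hd : 0 < d := ENNReal.toReal_pos h0 htop
    have hDd : D = ENNReal.ofReal d := (ENNReal.ofReal_toReal htop).symm
    have hTd : ∀ i : Fin (m + 1), ‖T i.succ - T 0‖ ≤ d := fun i => by
      rw [← dist_eq_norm, ← ENNReal.ofReal_le_ofReal_iff hd.le, ← edist_dist, ← hDd]
      exact hdist _ _
    obtain ⟨c, j, hj, hc, hw⟩ := h T hT d hd hTd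
    have key := hausdorffMeasure_convexHull_range_le T c j hj hc hd (by positivity) hTd hw
    rw [discreteCurvature, ← hD]
    refine ENNReal.div_le_of_le_mul (key.trans_eq ?_)
    rw [hDd, ENNReal.ofReal_rpow_of_pos hd, ← ENNReal.ofReal_pow hd.le,
      ← ENNReal.ofReal_mul (by positivity), ← ENNReal.ofReal_mul (by positivity)]
    congr 1
    have : d ^ m * d ^ (1 + β) = d ^ (β - 1) * d ^ (m + 2) := by
      rw [← Real.rpow_natCast d m, ← Real.rpow_natCast d (m + 2), ← Real.rpow_add hd,
        ← Real.rpow_add hd]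
      congr 1
      push_cast
      ring
    linear_combination (↑m + 1) ^ (m + 1) * 2 ^ (m + 1) * C * this

theorem ennreal_rpow_neg_le_rpow_neg {x y : ℝ≥0∞} {t : ℝ} (ht : 0 ≤ t) (hxy : x ≤ y) :
    y ^ (-t) ≤ x ^ (-t) := by
  rw [ENNReal.rpow_neg, ENNReal.rpow_neg]
  exact ENNReal.inv_le_inv.2 (ENNReal.rpow_le_rpow hxy ht)

/-- Decouples the variables: each of the `k` factors receives an equal share of the negative
exponent. -/
theorem ediam_range_rpow_neg_le_prod {X : Type*} [PseudoEMetricSpace X] {k : ℕ} (T : Fin (k + 1) → X)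
    {t : ℝ} (ht : 0 ≤ t) :
    Metric.ediam (Set.range T) ^ (-(t * k)) ≤ ∏ i : Fin k, edist (T i.succ) (T 0) ^ (-t) := by
  rw [← neg_mul, ENNReal.rpow_mul, ENNReal.rpow_natCast]
  calc _ = ∏ _i : Fin k, Metric.ediam (Set.range T) ^ (-t) := by simp
    _ ≤ _ := Finset.prod_le_prod' fun i _ => ennreal_rpow_neg_le_rpow_neg ht
      (Metric.edist_le_ediam_of_mem (Set.mem_range_self _) (Set.mem_range_self _))

theorem theorem4p1 (m n : ℕ) (p α : ℝ) (hp : (m : ℝ) * (m + 1) < p)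
    (hα : 1 - (m : ℝ) * (m + 1) / p < α) (S : Set (EuclideanSpace ℝ (Fin n)))
    (hS : IsCompact S) (hS' : IsC1HolderSubmanifold m α S) :
    pEnergy m p S < ∞ := by
  have hp0 : 0 < p := lt_of_le_of_lt (by positivity) hp
  have hα0 : 0 < α := by
    have : (m : ℝ) * (m + 1) / p < 1 := (div_lt_one hp0).2 hp
    linarith
  -- The cap at `1` keeps `t` nonnegative. If `m = 0` then `α > 1`, so `t = 0`.
  set β := min α 1 with hβ
  have hβ0 : 0 < β := lt_min hα0 one_pos
  have hβ1 : β ≤ 1 := min_le_right _ _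
  set t := (1 - β) * p / (m + 1) with ht
  have ht0 : 0 ≤ t := div_nonneg (mul_nonneg (by linarith) hp0.le) (by positivity)
  have htm : t < m ∨ t = 0 := by
    rcases le_total 1 α with h | h
    · right
      rw [ht, hβ, min_eq_right h]
      simp
    · left
      rw [ht, hβ, min_eq_left h, div_lt_iff₀ (by positivity)]
      have : 1 - α < (m : ℝ) * (m + 1) / p := by linarith
      exact (lt_div_iff₀ hp0).1 this
  obtain ⟨C, hC, hK⟩ := hS'.exists_discreteCurvature_le hS hβ0 (min_le_left _ _)
  obtain ⟨M, hM, hgrowth⟩ := hS'.exists_hausdorffMeasure_inter_closedBall_le hS hα0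
  have hfin : μH[(m : ℝ)] S < ∞ := by
    obtain ⟨R, hR, hSR⟩ := hS.isBounded.subset_closedBall_lt 0 0
    rw [← Set.inter_eq_left.2 hSR]
    exact (hgrowth 0 R hR).trans_lt (ENNReal.mul_lt_top hM ENNReal.ofReal_lt_top)
  set μ : Measure (EuclideanSpace ℝ (Fin n)) :=
    (μH[(m : ℝ)] : Measure (EuclideanSpace ℝ (Fin n))).restrict S with hμ
  have : IsFiniteMeasure μ := ⟨by rwa [hμ, Measure.restrict_apply_univ]⟩
  obtain ⟨A, hA, hAle⟩ : ∃ A < ∞, ∀ x, ∫⁻ y, edist y x ^ (-t) ∂μ ≤ A := by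
    rcases htm with h | h
    · refine ⟨_, ?_, fun x => lintegral_edist_rpow_neg_le μ ht0 (m := m) (C := M) fun r hr => ?_⟩
      · exact ENNReal.add_lt_top.2 ⟨measure_lt_top _ _,
          ENNReal.mul_lt_top (ENNReal.mul_lt_top hM ENNReal.ofReal_lt_top)
            (tsum_ofReal_two_rpow_pow_lt_top (by linarith))⟩
      · rw [hμ, Measure.restrict_apply Metric.isClosed_closedBall.measurableSet, Set.inter_comm]
        exact hgrowth x r hr
    · exact ⟨μ Set.univ, measure_lt_top _ _, fun x => by simp [h]⟩
  have hmem : ∀ᵐ T : Fin (m + 2) → EuclideanSpace ℝ (Fin n) ∂(Measure.pi fun _ => μ),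
      ∀ i, T i ∈ S :=
    ae_all_iff.2 fun i => (Measure.tendsto_eval_ae_ae (μ := fun _ : Fin (m + 2) => μ) (i := i)).eventually
      (ae_restrict_mem hS.measurableSet)
  have hmeas : Measurable (Function.uncurry fun y x : EuclideanSpace ℝ (Fin n) =>
      edist y x ^ (-t)) := measurable_edist.pow_const _
  calc pEnergy m p S = ∫⁻ T : Fin (m + 2) → EuclideanSpace ℝ (Fin n), discreteCurvature T ^ p
        ∂(Measure.pi fun _ => μ) := rfl
    _ ≤ ∫⁻ T : Fin (m + 2) → EuclideanSpace ℝ (Fin n),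
        C ^ p * ∏ i : Fin (m + 1), edist (T i.succ) (T 0) ^ (-t) ∂(Measure.pi fun _ => μ) := by
      refine lintegral_mono_ae (hmem.mono fun T hT => ?_)
      refine (ENNReal.rpow_le_rpow (hK T hT) hp0.le).trans ?_
      rw [ENNReal.mul_rpow_of_nonneg _ _ hp0.le, ← ENNReal.rpow_mul]
      have he : (β - 1) * p = -(t * ((m + 1 : ℕ) : ℝ)) := by
        rw [ht]; push_cast; field_simp; ring
      rw [he]
      gcongr
      exact ediam_range_rpow_neg_le_prod T ht0
    _ = C ^ p * ∫⁻ T : Fin (m + 2) → EuclideanSpace ℝ (Fin n),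
        ∏ i : Fin (m + 1), edist (T i.succ) (T 0) ^ (-t) ∂(Measure.pi fun _ => μ) :=
      lintegral_const_mul' _ _ (ENNReal.rpow_lt_top_of_nonneg hp0.le hC.ne).ne
    _ ≤ C ^ p * (μ Set.univ * A ^ (m + 1)) := by
      gcongr
      exact lintegral_pi_prod_le μ (m + 1) hmeas hAle
    _ < ∞ := ENNReal.mul_lt_top (ENNReal.rpow_lt_top_of_nonneg hp0.le hC.ne)
      (ENNReal.mul_lt_top (measure_lt_top _ _) (ENNReal.pow_lt_top hA))
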